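/- Let $\ell^\infty$ be the Banach space of bounded real sequences $x=(x_n)_{n\in\mathbb{Z}}$ with the supremum norm, and let $U$ be the bilateral right shift on $\ell^\infty$, $(Ux)_n=x_{n-1}$. For $q(0)\in\ell^\infty$ let $q(t)=\mathrm{e}^{(U-I)t}q(0)$ be the solution of the serial pursuit equation $\dot q=(U-I)q$, that is, of $\dot q_n=q_{n-1}-q_n$ for all $n\in\mathbb{Z}$. There exist initial conditions $q(0)\in\ell^\infty$ such that $q_n(0)\in\{0,1\}$ for every $n\in\mathbb{Z}$ and such that, for all integers $m\ge 0$ and $k$ with $m^2\le k<m^2+m$, one has $q_{-k}(0)=1$ if $m$ is even and $q_{-k}(0)=0$ if $m$ is odd. For every such initial condition, whatever its values in $\{0,1\}$ at the remaining indices, $q_0(t)$ does not converge as $t\to\infty$. -/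

import Mathlib

open Filter Topology
open scoped ENNReal

noncomputable section

namespace CarChain

/-- The Banach space of bounded real sequences indexed by the integers, with the sup norm. -/
abbrev BddSeq : Type := lp (fun _ : ℤ => ℝ) ∞

/-- The bilateral right shift on bounded sequences, `(U x) n = x (n - 1)`, as a bounded operator. -/
def rightShift : BddSeq →L[ℝ] BddSeq :=
  LinearMap.mkContinuous
    { toFun := fun x => ⟨fun n => x (n - 1), by
        refine memℓp_infty ⟨‖x‖, ?_⟩
        rintro _ ⟨n, rfl⟩
        exact lp.norm_apply_le_norm ENNReal.top_ne_zero x (n - 1)⟩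
      map_add' := fun _ _ => rfl
      map_smul' := fun _ _ => rfl }
    1 (by
      intro x
      rw [one_mul]
      exact lp.norm_le_of_forall_le (norm_nonneg x)
        (fun n => lp.norm_apply_le_norm ENNReal.top_ne_zero x (n - 1)))

theorem rightShift_apply (x : BddSeq) (n : ℤ) : rightShift x n = x (n - 1) := rfl

/-- The solution `q(t) = exp ((U - I) t) q(0)` of the serial pursuit equation `q' = (U - I) q`, that
is, of `q_n' = q_{n-1} - q_n` for all integers `n`, with the initial condition `q₀`. -/
def pursuit (q₀ : BddSeq) (t : ℝ) : BddSeq :=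
  NormedSpace.exp (t • (rightShift - ContinuousLinearMap.id ℝ BddSeq)) q₀

theorem pursuit_zero (q₀ : BddSeq) : pursuit q₀ 0 = q₀ := by
  have h : (0 : ℝ) • (rightShift - ContinuousLinearMap.id ℝ BddSeq) = 0 :=
    zero_smul ℝ (rightShift - ContinuousLinearMap.id ℝ BddSeq)
  rw [pursuit, h, NormedSpace.exp_zero]
  rfl

theorem hasDerivAt_pursuit (q₀ : BddSeq) (t : ℝ) :
    HasDerivAt (pursuit q₀) (rightShift (pursuit q₀ t) - pursuit q₀ t) t := by
  have h := hasDerivAt_exp_smul_const' (𝕂 := ℝ)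
    (rightShift - ContinuousLinearMap.id ℝ BddSeq) t
  exact ((ContinuousLinearMap.apply ℝ BddSeq q₀).hasFDerivAt.comp_hasDerivAt t h)

/-- The initial conditions of the example: every car starts at `0` or at `1`; the cars `-k` with
`m² ≤ k < m² + m` start at `1` if `m` is even and at `0` if `m` is odd.  The remaining cars
are unconstrained (apart from starting at `0` or `1`). -/
structure IsAlternatingStart (q₀ : BddSeq) : Prop where
  zero_or_one : ∀ n : ℤ, q₀ n = 0 ∨ q₀ n = 1
  even_block : ∀ m k : ℕ, Even m → m ^ 2 ≤ k → k < m ^ 2 + m → q₀ (-(k : ℤ)) = 1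
  odd_block : ∀ m k : ℕ, Odd m → m ^ 2 ≤ k → k < m ^ 2 + m → q₀ (-(k : ℤ)) = 0

/-- The coordinates of `pursuit` satisfy the equations of serial pursuit. -/
theorem hasDerivAt_pursuit_apply (q₀ : BddSeq) (n : ℤ) (t : ℝ) :
    HasDerivAt (fun s => pursuit q₀ s n) (pursuit q₀ t (n - 1) - pursuit q₀ t n) t :=
  (lp.evalCLM ℝ (fun _ : ℤ => ℝ) ∞ n).hasFDerivAt.comp_hasDerivAt t (hasDerivAt_pursuit q₀ t)

end CarChain

end

namespace CarChain

open MeasureTheory Set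
open scoped Nat

/-! Expanding `e^{-t} e^{tU}` shows that `q_0(t)` is the Poisson mean of the values `q_{-k}(0)`.
With `s k = 2 q_{-k}(0) - 1` the problem becomes the divergence of `F(t) = ∑ s k * poissonWeight k
t`, where `s` has sign `(-1)^m` on roughly the first half of the block `[m², (m+1)²)` and is only
bounded by 1 elsewhere.

Test `F` on the window `[(2h)², (2h+n)²]` against a cosine of frequency `tan θ`, `θ = π/(4h)`. If
`F` tended to `L`, this integral would be at most a small multiple of `n h`, plus `O((|L| + 1) h)`.
On the other hand each weight is a Gamma density in `t`, so its full cosine integral is explicit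
(`integral_poissonWeight_mul_cos`), and cutting to the window costs only `O(h)` in total
(`sum_range_crossMass_le`, `abs_integral_tsum_sub_le`). What remains is a correlation of `s` with a
damped cosine of half-period `4h`, about the length of a block. The prescribed half lies where the
cosine is largest, so it beats the free half whatever its values: each of the `n` blocks gains a
multiple of `h` (`IsAlternatingSign.damped_sum_ge`). Fixing `n` large in terms of `|L|` and then `h`
large gives the contradiction. -/

/-! ### Poisson weights and incomplete Gamma integrals. -/

/-- The Poisson weight `e⁻ᵗ tᵏ / k!`. -/
noncomputable def poissonWeight (k : ℕ) (t : ℝ) : ℝ := Real.exp (-t) * t ^ k / k !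

theorem poissonWeight_nonneg (k : ℕ) {t : ℝ} (ht : 0 ≤ t) : 0 ≤ poissonWeight k t := by
  unfold poissonWeight; positivity

theorem continuous_poissonWeight (k : ℕ) : Continuous (poissonWeight k) := by
  unfold poissonWeight; fun_prop

theorem hasSum_poissonWeight (t : ℝ) : HasSum (fun k => poissonWeight k t) 1 := by
  have h := (NormedSpace.expSeries_div_hasSum_exp (𝔸 := ℝ) t).mul_left (Real.exp (-t))
  rw [← congrFun Real.exp_eq_exp_ℝ t, ← Real.exp_add, neg_add_cancel, Real.exp_zero] at h
  simpa only [poissonWeight, mul_div_assoc] using h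

theorem hasDerivAt_poissonWeight_succ (k : ℕ) (t : ℝ) :
    HasDerivAt (poissonWeight (k + 1)) (poissonWeight k t - poissonWeight (k + 1) t) t := by
  have h := (((hasDerivAt_neg t).exp).mul (hasDerivAt_pow (k + 1) t)).div_const ((k + 1)! : ℝ)
  refine h.congr_deriv ?_
  have hk : ((k ! : ℕ) : ℝ) ≠ 0 := by positivity
  have hk' : ((k : ℝ) + 1) ≠ 0 := by positivity
  simp only [poissonWeight, Nat.factorial_succ, Nat.cast_mul, Nat.cast_succ, Nat.add_sub_cancel]
  field_simp
  ring

theorem poissonWeight_succ (k : ℕ) (t : ℝ) :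
    (k + 1) * poissonWeight (k + 1) t = t * poissonWeight k t := by
  have hk : ((k ! : ℕ) : ℝ) ≠ 0 := by positivity
  have hk' : ((k : ℝ) + 1) ≠ 0 := by positivity
  simp only [poissonWeight, Nat.factorial_succ, Nat.cast_mul, Nat.cast_succ]
  field_simp
  ring

theorem integrableOn_poissonWeight (k : ℕ) : IntegrableOn (poissonWeight k) (Ioi 0) := by
  have h := Real.GammaIntegral_convergent (s := k + 1) (by positivity)
  have h' : IntegrableOn (fun t : ℝ => Real.exp (-t) * t ^ ((k : ℝ) + 1 - 1) / k !) (Ioi 0) :=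
    Integrable.div_const h _
  refine h'.congr_fun (fun t _ => ?_) measurableSet_Ioi
  simp [poissonWeight]

/-- The incomplete Gamma integral `∫₀ˣ e⁻ᵗ tᵏ / k! dt`. -/
noncomputable def poissonTail (k : ℕ) (x : ℝ) : ℝ := ∫ t in (0 : ℝ)..x, poissonWeight k t

theorem poissonTail_zero (x : ℝ) : poissonTail 0 x = 1 - poissonWeight 0 x := by
  have h : ∀ t ∈ uIcc 0 x, HasDerivAt (fun t => -Real.exp (-t)) (poissonWeight 0 t) t := by
    intro t _
    refine ((hasDerivAt_neg t).exp).neg.congr_deriv ?_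
    simp [poissonWeight]
  rw [poissonTail, intervalIntegral.integral_eq_sub_of_hasDerivAt h
    ((continuous_poissonWeight 0).intervalIntegrable _ _)]
  simp [poissonWeight]
  ring

theorem poissonTail_sub_succ (k : ℕ) (x : ℝ) :
    poissonTail k x - poissonTail (k + 1) x = poissonWeight (k + 1) x := by
  have h := intervalIntegral.integral_eq_sub_of_hasDerivAt
    (fun t (_ : t ∈ uIcc 0 x) => hasDerivAt_poissonWeight_succ k t)
    (((continuous_poissonWeight k).sub (continuous_poissonWeight (k + 1))).intervalIntegrable _ _)
  rw [intervalIntegral.integral_sub ((continuous_poissonWeight k).intervalIntegrable _ _)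
    ((continuous_poissonWeight _).intervalIntegrable _ _)] at h
  rw [poissonTail, poissonTail, h]
  simp [poissonWeight]

theorem poissonTail_nonneg (k : ℕ) {x : ℝ} (hx : 0 ≤ x) : 0 ≤ poissonTail k x :=
  intervalIntegral.integral_nonneg hx fun _ ht => poissonWeight_nonneg k ht.1

/-- Gives the sign of the boundary term at the upper end of the telescoping sum below, which can
then be dropped. -/
theorem succ_mul_poissonTail_succ_le (k : ℕ) {x : ℝ} (hx : 0 ≤ x) :
    (k + 1) * poissonTail (k + 1) x ≤ x * poissonTail k x := by
  rw [poissonTail, poissonTail, ← intervalIntegral.integral_const_mul,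
    ← intervalIntegral.integral_const_mul]
  refine intervalIntegral.integral_mono_on hx
    (((continuous_poissonWeight _).const_mul _).intervalIntegrable _ _)
    (((continuous_poissonWeight _).const_mul _).intervalIntegrable _ _) fun t ht => ?_
  rw [poissonWeight_succ]
  exact mul_le_mul_of_nonneg_right ht.2 (poissonWeight_nonneg k ht.1)

/-- Telescoping: `G n = x * poissonTail n x - (n + 1) * poissonTail (n + 1) x` satisfies `G n - G (n
+ 1) = poissonTail (n + 1) x`. -/
theorem sum_range_poissonTail_add (n K : ℕ) (x : ℝ) :
    ∑ i ∈ Finset.range K, poissonTail (n + 1 + i) x =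
      x * poissonTail n x - (n + 1) * poissonTail (n + 1) x -
        (x * poissonTail (n + K) x - (n + K + 1) * poissonTail (n + K + 1) x) := by
  induction K with
  | zero => simp
  | succ K ih =>
    rw [Finset.sum_range_succ, ih]
    have h1 := poissonTail_sub_succ (n + K) x
    have h2 := poissonTail_sub_succ (n + K + 1) x
    have h3 := poissonWeight_succ (n + K + 1) x
    rw [← h1, ← h2] at h3
    rw [show n + 1 + K = n + K + 1 by ring, show n + (K + 1) = n + K + 1 by ring]
    push_cast at h3 ⊢
    linarith

theorem sum_range_one_sub_poissonTail (n : ℕ) (x : ℝ) :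
    ∑ k ∈ Finset.range (n + 1), (1 - poissonTail k x) =
      n + 1 - x + x * poissonTail n x - (n + 1) * poissonTail (n + 1) x := by
  induction n with
  | zero =>
    have h1 := poissonTail_sub_succ 0 x
    have h2 := poissonWeight_succ 0 x
    have h3 := poissonTail_zero x
    simp at h1 h2 h3 ⊢
    rw [← h1] at h2
    linear_combination -h2 - x * h3
  | succ n ih =>
    rw [Finset.sum_range_succ, ih]
    have h1 := poissonTail_sub_succ n x
    have h2 := poissonTail_sub_succ (n + 1) x
    have h3 := poissonWeight_succ (n + 1) x
    rw [← h1, ← h2] at h3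
    push_cast at h3 ⊢
    linarith

/-- Stirling's lower bound for `a!`, with `√(2πa)` weakened to `2√a`. -/
theorem mul_poissonWeight_self_le (a : ℕ) : 2 * (a * poissonWeight a a) ≤ √a := by
  have h := Stirling.le_factorial_stirling a
  have hf : (0 : ℝ) < a ! := by positivity
  have he : Real.exp (-a) * (a : ℝ) ^ a = (a / Real.exp 1) ^ a := by
    rw [div_pow, ← Real.exp_nat_mul, mul_one, Real.exp_neg]; ring
  have hs : 2 * √a ≤ √(2 * Real.pi * a) := by
    refine Real.le_sqrt_of_sq_le ?_
    rw [mul_pow, Real.sq_sqrt (by positivity)]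
    nlinarith [Real.pi_gt_three, (Nat.cast_nonneg a : (0 : ℝ) ≤ a)]
  rw [poissonWeight, he]
  have h1 : 2 * √a * (a / Real.exp 1) ^ a ≤ a ! :=
    (mul_le_mul_of_nonneg_right hs (by positivity)).trans h
  have h2 : (a : ℝ) = √a * √a := (Real.mul_self_sqrt (by positivity)).symm
  calc 2 * (a * ((a / Real.exp 1) ^ a / a !))
      = √a * (2 * √a * (a / Real.exp 1) ^ a) / a ! := by
        nth_rewrite 1 [h2]; ring
    _ ≤ √a * a ! / a ! := by gcongr
    _ = √a := by field_simp

/-- The mass that the `k`-th Gamma density has on the side of `a` opposite to `k`. -/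
noncomputable def crossMass (a k : ℕ) : ℝ :=
  if k < a then 1 - poissonTail k a else poissonTail k a

/-- By the telescoping formulas the indices below `a` contribute exactly `a * poissonWeight a a`,
and those from `a` on at most as much. The bound is uniform in `K`. -/
theorem sum_range_crossMass_le {a : ℕ} (ha : 0 < a) (K : ℕ) :
    ∑ k ∈ Finset.range (a + K), crossMass a k ≤ √a := by
  obtain ⟨n, rfl⟩ : ∃ n, a = n + 1 := ⟨a - 1, by omega⟩
  rw [Finset.sum_range_add]
  have e1 : ∑ k ∈ Finset.range (n + 1), crossMass (n + 1) k =
      ∑ k ∈ Finset.range (n + 1), (1 - poissonTail k (n + 1 : ℕ)) :=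
    Finset.sum_congr rfl fun k hk => if_pos (Finset.mem_range.1 hk)
  have e2 : ∑ k ∈ Finset.range K, crossMass (n + 1) (n + 1 + k) =
      ∑ k ∈ Finset.range K, poissonTail (n + 1 + k) (n + 1 : ℕ) :=
    Finset.sum_congr rfl fun k _ => if_neg (by omega)
  rw [e1, e2, sum_range_one_sub_poissonTail, sum_range_poissonTail_add]
  have h1 := succ_mul_poissonTail_succ_le (n + K) (x := (n + 1 : ℕ)) (by positivity)
  have h2 := mul_poissonWeight_self_le (n + 1)
  rw [← poissonTail_sub_succ n] at h2
  push_cast at *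
  linarith

/-! ### Fourier transform of the Gamma densities. -/

theorem tendsto_poissonWeight_atTop (k : ℕ) : Tendsto (poissonWeight k) atTop (𝓝 0) := by
  have h := (Real.tendsto_pow_mul_exp_neg_atTop_nhds_zero k).div_const (k ! : ℝ)
  rw [zero_div] at h
  exact h.congr fun t => by rw [poissonWeight, mul_comm]

theorem integrableOn_poissonWeight_mul_cexp (k : ℕ) (β : ℝ) :
    IntegrableOn (fun t : ℝ => (poissonWeight k t : ℂ) * Complex.exp (β * t * Complex.I))
      (Ioi 0) := by
  refine Integrable.mul_bdd (c := 1) (integrableOn_poissonWeight k).ofReal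
    (Continuous.aestronglyMeasurable (by fun_prop)) (Eventually.of_forall fun t => ?_)
  rw [← Complex.ofReal_mul, Complex.norm_exp_ofReal_mul_I]

theorem hasDerivAt_cexp_mul_I (β t : ℝ) :
    HasDerivAt (fun t : ℝ => Complex.exp (β * t * Complex.I))
      (β * Complex.I * Complex.exp (β * t * Complex.I)) t := by
  have h : HasDerivAt (fun t : ℝ => (β * t * Complex.I : ℂ)) (β * Complex.I) t := by
    simpa using ((Complex.ofRealCLM.hasDerivAt (x := t)).const_mul (β : ℂ)).mul_const Complex.I
  exact h.cexp.congr_deriv (mul_comm _ _)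

theorem tendsto_poissonWeight_mul_cexp (k : ℕ) (β : ℝ) :
    Tendsto (fun t : ℝ => (poissonWeight k t : ℂ) * Complex.exp (β * t * Complex.I))
      atTop (𝓝 0) := by
  rw [tendsto_zero_iff_norm_tendsto_zero]
  refine (tendsto_zero_iff_norm_tendsto_zero.1 (tendsto_poissonWeight_atTop k)).congr fun t => ?_
  rw [norm_mul, ← Complex.ofReal_mul, Complex.norm_exp_ofReal_mul_I, mul_one, Complex.norm_real]

theorem integral_poissonWeight_mul_cexp (k : ℕ) (β : ℝ) :
    (1 - β * Complex.I) ^ (k + 1) *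
      ∫ t in Ioi (0 : ℝ), (poissonWeight k t : ℂ) * Complex.exp (β * t * Complex.I) = 1 := by
  induction k with
  | zero =>
    have hd : ∀ t ∈ Ici (0 : ℝ), HasDerivAt
        (fun t : ℝ => (poissonWeight 0 t : ℂ) * Complex.exp (β * t * Complex.I))
        (-(1 - β * Complex.I) * ((poissonWeight 0 t : ℂ) * Complex.exp (β * t * Complex.I))) t := by
      intro t _
      have h0 : HasDerivAt (poissonWeight 0) (-poissonWeight 0 t) t := by
        have : poissonWeight 0 = fun t => Real.exp (-t) := by
          funext s; simp [poissonWeight]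
        rw [this]
        exact ((hasDerivAt_neg t).exp).congr_deriv (by simp)
      refine (h0.ofReal_comp.mul (hasDerivAt_cexp_mul_I β t)).congr_deriv ?_
      push_cast
      ring
    have h := integral_Ioi_of_hasDerivAt_of_tendsto' hd
      ((integrableOn_poissonWeight_mul_cexp 0 β).const_mul _) (tendsto_poissonWeight_mul_cexp 0 β)
    rw [integral_const_mul] at h
    simp [poissonWeight] at h ⊢
    linear_combination -h
  | succ k ih =>
    have hd : ∀ t ∈ Ici (0 : ℝ), HasDerivAt
        (fun t : ℝ => (poissonWeight (k + 1) t : ℂ) * Complex.exp (β * t * Complex.I))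
        ((poissonWeight k t : ℂ) * Complex.exp (β * t * Complex.I) -
          (1 - β * Complex.I) *
            ((poissonWeight (k + 1) t : ℂ) * Complex.exp (β * t * Complex.I))) t := by
      intro t _
      refine ((hasDerivAt_poissonWeight_succ k t).ofReal_comp.mul
        (hasDerivAt_cexp_mul_I β t)).congr_deriv ?_
      push_cast
      ring
    have h := integral_Ioi_of_hasDerivAt_of_tendsto' hd
      ((integrableOn_poissonWeight_mul_cexp k β).sub
        ((integrableOn_poissonWeight_mul_cexp (k + 1) β).const_mul _))
      (tendsto_poissonWeight_mul_cexp (k + 1) β)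
    rw [integral_sub (integrableOn_poissonWeight_mul_cexp k β)
      ((integrableOn_poissonWeight_mul_cexp (k + 1) β).const_mul _), integral_const_mul] at h
    have h0 : poissonWeight (k + 1) 0 = 0 := by simp [poissonWeight]
    rw [h0, Complex.ofReal_zero, zero_mul, sub_zero, sub_eq_zero] at h
    refine Eq.trans ?_ ih
    rw [h]
    ring

/-- The choice of frequency `tan θ` makes `1 / (1 - i tan θ) = cos θ * e^{iθ}`, so the `(k+1)`-st
power separates into a damping factor and a pure phase. -/
theorem integral_poissonWeight_mul_cos (k : ℕ) {θ : ℝ} (hθ : 0 < Real.cos θ) (δ : ℝ) :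
    ∫ t in Ioi (0 : ℝ), poissonWeight k t * Real.cos (Real.tan θ * t - δ) =
      Real.cos θ ^ (k + 1) * Real.cos ((k + 1) * θ - δ) := by
  set J := ∫ t in Ioi (0 : ℝ), (poissonWeight k t : ℂ) * Complex.exp (Real.tan θ * t * Complex.I)
    with hJdef
  have hθ' : (Real.cos θ : ℂ) ≠ 0 := by exact_mod_cast hθ.ne'
  have hinv : (Real.cos θ * Complex.exp (θ * Complex.I)) * (1 - Real.tan θ * Complex.I) = 1 := by
    have h2 : (Real.cos θ : ℂ) ^ 2 + (Real.sin θ : ℂ) ^ 2 = 1 := by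
      exact_mod_cast Real.cos_sq_add_sin_sq θ
    rw [Complex.exp_mul_I, Real.tan_eq_sin_div_cos, ← Complex.ofReal_cos, ← Complex.ofReal_sin]
    push_cast [Complex.ofReal_div] at *
    field_simp
    linear_combination h2 - Complex.sin θ ^ 2 * Complex.I_sq
  have hJ : J = Real.cos θ ^ (k + 1) * Complex.exp (((k + 1) * θ : ℝ) * Complex.I) := by
    have h := integral_poissonWeight_mul_cexp k (Real.tan θ)
    have hexp : Complex.exp (((k + 1) * θ : ℝ) * Complex.I) =
        Complex.exp (θ * Complex.I) ^ (k + 1) := by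
      rw [← Complex.exp_nat_mul]; push_cast; ring_nf
    calc J = ((Real.cos θ * Complex.exp (θ * Complex.I)) * (1 - Real.tan θ * Complex.I)) ^ (k + 1)
          * J := by rw [hinv, one_pow, one_mul]
      _ = (Real.cos θ * Complex.exp (θ * Complex.I)) ^ (k + 1) *
          ((1 - Real.tan θ * Complex.I) ^ (k + 1) * J) := by
        rw [mul_pow (_ * _) (1 - _), mul_assoc]
      _ = _ := by rw [h, mul_one, mul_pow, hexp]
  have hre : ∫ t in Ioi (0 : ℝ), poissonWeight k t * Real.cos (Real.tan θ * t - δ) =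
      (J * Complex.exp ((-δ : ℝ) * Complex.I)).re := by
    rw [hJdef, ← integral_mul_const]
    have h := integral_re (𝕜 := ℂ) ((integrableOn_poissonWeight_mul_cexp k (Real.tan θ)).mul_const
      (Complex.exp ((-δ : ℝ) * Complex.I)))
    refine Eq.trans ?_ h
    refine integral_congr_ae (Eventually.of_forall fun t => ?_)
    show _ * Real.cos (_ - _) = Complex.re _
    rw [mul_assoc, ← Complex.exp_add, Complex.re_ofReal_mul, ← add_mul, ← Complex.ofReal_mul,
      ← Complex.ofReal_add, Complex.exp_ofReal_mul_I_re, sub_eq_add_neg]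
  rw [hre, hJ, mul_assoc, ← Complex.exp_add, ← add_mul, ← Complex.ofReal_add,
    ← Complex.ofReal_pow, Complex.re_ofReal_mul, Complex.exp_ofReal_mul_I_re, sub_eq_add_neg]

theorem integral_poissonWeight (k : ℕ) : ∫ t in Ioi (0 : ℝ), poissonWeight k t = 1 := by
  simpa using integral_poissonWeight_mul_cos k (θ := 0) (by simp) 0

/-! ### Localization of the cosine integral to a window. -/

theorem integral_Ioi_poissonWeight (k : ℕ) (x : ℝ) (hx : 0 ≤ x) :
    ∫ t in Ioi x, poissonWeight k t = 1 - poissonTail k x := by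
  have h := intervalIntegral.integral_Ioi_sub_Ioi (integrableOn_poissonWeight k) hx
  rw [integral_poissonWeight] at h
  rw [poissonTail]
  linarith

theorem poissonTail_le_one (k : ℕ) {x : ℝ} (hx : 0 ≤ x) : poissonTail k x ≤ 1 := by
  have h : 0 ≤ ∫ t in Ioi x, poissonWeight k t :=
    setIntegral_nonneg measurableSet_Ioi fun t ht =>
      poissonWeight_nonneg k (hx.trans (le_of_lt ht))
  rw [integral_Ioi_poissonWeight k x hx] at h
  linarith

theorem crossMass_nonneg (a k : ℕ) : 0 ≤ crossMass a k := by
  unfold crossMass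
  split_ifs
  · exact sub_nonneg.2 (poissonTail_le_one k a.cast_nonneg)
  · exact poissonTail_nonneg k a.cast_nonneg

theorem abs_poissonWeight_mul_cos_le (k : ℕ) (β δ : ℝ) {t : ℝ} (ht : 0 ≤ t) :
    |poissonWeight k t * Real.cos (β * t - δ)| ≤ poissonWeight k t := by
  rw [abs_mul, abs_of_nonneg (poissonWeight_nonneg k ht)]
  exact mul_le_of_le_one_right (poissonWeight_nonneg k ht) (Real.abs_cos_le_one _)

theorem continuous_poissonWeight_mul_cos (k : ℕ) (β δ : ℝ) :
    Continuous fun t => poissonWeight k t * Real.cos (β * t - δ) :=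
  (continuous_poissonWeight k).mul (by fun_prop)

theorem integrableOn_poissonWeight_mul_cos (k : ℕ) (β δ : ℝ) :
    IntegrableOn (fun t => poissonWeight k t * Real.cos (β * t - δ)) (Ioi 0) :=
  Integrable.mono' (integrableOn_poissonWeight k)
    (continuous_poissonWeight_mul_cos k β δ).aestronglyMeasurable
    ((ae_restrict_mem measurableSet_Ioi).mono fun _ ht =>
      abs_poissonWeight_mul_cos_le k β δ (le_of_lt ht))

theorem abs_intervalIntegral_poissonWeight_mul_cos_le (k : ℕ) (β δ : ℝ) {x y : ℝ} (hx : 0 ≤ x)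
    (hxy : x ≤ y) :
    |∫ t in x..y, poissonWeight k t * Real.cos (β * t - δ)| ≤
      poissonTail k y - poissonTail k x := by
  have h : poissonTail k y - poissonTail k x = ∫ t in x..y, poissonWeight k t :=
    intervalIntegral.integral_interval_sub_left
      ((continuous_poissonWeight k).intervalIntegrable _ _)
      ((continuous_poissonWeight k).intervalIntegrable _ _)
  rw [h, ← Real.norm_eq_abs]
  refine intervalIntegral.norm_integral_le_of_norm_le hxy (Eventually.of_forall fun t ht => ?_)
    ((continuous_poissonWeight k).intervalIntegrable _ _)
  exact abs_poissonWeight_mul_cos_le k β δ (hx.trans (le_of_lt ht.1))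

theorem abs_integral_Ioi_poissonWeight_mul_cos_le (k : ℕ) (β δ : ℝ) {x : ℝ} (hx : 0 ≤ x) :
    |∫ t in Ioi x, poissonWeight k t * Real.cos (β * t - δ)| ≤ 1 - poissonTail k x := by
  rw [← integral_Ioi_poissonWeight k x hx, ← Real.norm_eq_abs]
  refine norm_integral_le_of_norm_le ((integrableOn_poissonWeight k).mono_set (Ioi_subset_Ioi hx))
    ((ae_restrict_mem measurableSet_Ioi).mono fun t ht => ?_)
  exact abs_poissonWeight_mul_cos_le k β δ (hx.trans (le_of_lt ht))

/-- On a window, the Gamma average of a cosine localizes to the indices in the window. -/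
theorem abs_windowIntegral_sub_le (k : ℕ) {a b : ℕ} (hab : a ≤ b) {θ : ℝ} (hθ : 0 < Real.cos θ)
    (δ : ℝ) :
    |(∫ t in (a : ℝ)..b, poissonWeight k t * Real.cos (Real.tan θ * t - δ)) -
      (if k ∈ Finset.Ico a b then Real.cos θ ^ (k + 1) * Real.cos ((k + 1) * θ - δ) else 0)| ≤
      crossMass a k + crossMass b k := by
  have ha : (0 : ℝ) ≤ a := a.cast_nonneg
  have hab' : (a : ℝ) ≤ b := by exact_mod_cast hab
  have hca := crossMass_nonneg a k
  have hcb := crossMass_nonneg b k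
  have hw := abs_intervalIntegral_poissonWeight_mul_cos_le k (Real.tan θ) δ ha hab'
  by_cases hk : k ∈ Finset.Ico a b
  · rw [if_pos hk, ← integral_poissonWeight_mul_cos k hθ δ]
    rw [Finset.mem_Ico] at hk
    have hi := integrableOn_poissonWeight_mul_cos k (Real.tan θ) δ
    have h1 := intervalIntegral.integral_Ioi_sub_Ioi hi (ha.trans hab')
    have hc := continuous_poissonWeight_mul_cos k (Real.tan θ) δ
    have h2 := intervalIntegral.integral_add_adjacent_intervals
      (hc.intervalIntegrable (μ := volume) 0 a) (hc.intervalIntegrable (μ := volume) a b)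
    have h3 := abs_intervalIntegral_poissonWeight_mul_cos_le k (Real.tan θ) δ le_rfl ha
    have h4 := abs_integral_Ioi_poissonWeight_mul_cos_le k (Real.tan θ) δ (ha.trans hab')
    have h5 : poissonTail k 0 = 0 := intervalIntegral.integral_same
    rw [crossMass, crossMass, if_neg (by omega), if_pos hk.2]
    rw [h5, sub_zero] at h3
    rw [abs_le] at *
    constructor <;> linarith
  · rw [if_neg hk, sub_zero]
    rw [Finset.mem_Ico, not_and_or, not_le, not_lt] at hk
    rcases hk with hk | hk
    · have := poissonTail_le_one k (ha.trans hab')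
      have : crossMass a k = 1 - poissonTail k a := if_pos hk
      linarith
    · have := poissonTail_nonneg k ha
      have : crossMass b k = poissonTail k b := if_neg (by omega)
      linarith

theorem hasSum_windowIntegral {s : ℕ → ℝ} (hs : ∀ k, |s k| ≤ 1) {a b : ℝ} (ha : 0 ≤ a)
    (hab : a ≤ b) (β δ : ℝ) :
    HasSum (fun k => s k * ∫ t in a..b, poissonWeight k t * Real.cos (β * t - δ))
      (∫ t in a..b, (∑' k, s k * poissonWeight k t) * Real.cos (β * t - δ)) := by
  let f : ℕ → C(ℝ, ℝ) := fun k =>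
    ⟨fun t => s k * (poissonWeight k t * Real.cos (β * t - δ)),
      (continuous_poissonWeight_mul_cos k β δ).const_mul _⟩
  have hf : Summable fun k =>
      ‖(f k).restrict (⟨uIcc a b, isCompact_uIcc⟩ : TopologicalSpace.Compacts ℝ)‖ := by
    -- On `[a, b]` the `k`-th term is at most `b^k / k!`, which permits termwise integration.
    refine Summable.of_nonneg_of_le (fun _ => norm_nonneg _) (fun k => ?_)
      (Real.summable_pow_div_factorial b)
    have hb : 0 ≤ b := ha.trans hab
    rw [ContinuousMap.norm_le _ (by positivity)]
    rintro ⟨t, ht⟩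
    replace ht : t ∈ uIcc a b := ht
    rw [uIcc_of_le hab] at ht
    have ht0 : 0 ≤ t := ha.trans ht.1
    show |s k * (poissonWeight k t * Real.cos (β * t - δ))| ≤ _
    rw [abs_mul]
    calc |s k| * |poissonWeight k t * Real.cos (β * t - δ)|
        ≤ 1 * poissonWeight k t := mul_le_mul (hs k) (abs_poissonWeight_mul_cos_le k β δ ht0)
          (abs_nonneg _) zero_le_one
      _ = Real.exp (-t) * t ^ k / k ! := one_mul _
      _ ≤ 1 * b ^ k / k ! := by
        have := ht.2
        gcongr
        exact Real.exp_le_one_iff.2 (by linarith)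
      _ = b ^ k / k ! := by rw [one_mul]
  have h := intervalIntegral.hasSum_intervalIntegral_of_summable_norm hf
  have e1 : (fun k => s k * ∫ t in a..b, poissonWeight k t * Real.cos (β * t - δ)) =
      fun k => ∫ t in a..b, f k t := by
    funext k
    exact (intervalIntegral.integral_const_mul _ _).symm
  have e2 : (fun t => (∑' k, s k * poissonWeight k t) * Real.cos (β * t - δ)) =
      fun t => ∑' k, f k t := by
    funext t
    rw [← tsum_mul_right]
    exact tsum_congr fun k => mul_assoc _ _ _
  rw [e1, e2]
  exact h

theorem abs_integral_tsum_sub_le {s : ℕ → ℝ} (hs : ∀ k, |s k| ≤ 1) {a b : ℕ} (ha : 0 < a)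
    (hab : a ≤ b) {θ : ℝ} (hθ : 0 < Real.cos θ) (δ : ℝ) :
    |(∫ t in (a : ℝ)..b, (∑' k, s k * poissonWeight k t) * Real.cos (Real.tan θ * t - δ)) -
      ∑ k ∈ Finset.Ico a b, s k * (Real.cos θ ^ (k + 1) * Real.cos ((k + 1) * θ - δ))| ≤
      √a + √b := by
  have h := (hasSum_windowIntegral hs a.cast_nonneg (Nat.cast_le (α := ℝ).2 hab)
    (Real.tan θ) δ).tendsto_sum_nat
  refine le_of_tendsto (h.sub_const _).abs ?_
  filter_upwards [eventually_ge_atTop b] with n hn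
  have e : ∑ k ∈ Finset.Ico a b, s k * (Real.cos θ ^ (k + 1) * Real.cos ((k + 1) * θ - δ)) =
      ∑ k ∈ Finset.range n, s k * (if k ∈ Finset.Ico a b then
        Real.cos θ ^ (k + 1) * Real.cos ((k + 1) * θ - δ) else 0) := by
    simp only [mul_ite, mul_zero]
    rw [Finset.sum_ite_mem]
    congr 1
    ext k
    simp only [Finset.mem_inter, Finset.mem_range, Finset.mem_Ico]
    omega
  rw [e, ← Finset.sum_sub_distrib]
  refine (Finset.abs_sum_le_sum_abs _ _).trans ?_
  have h1 := sum_range_crossMass_le ha (n - a)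
  have h2 := sum_range_crossMass_le (ha.trans_le hab) (n - b)
  rw [Nat.add_sub_cancel' (hab.trans hn)] at h1
  rw [Nat.add_sub_cancel' hn] at h2
  refine le_trans (Finset.sum_le_sum fun k _ => ?_) ((Finset.sum_add_distrib).trans_le
    (add_le_add h1 h2))
  rw [← mul_sub, abs_mul]
  exact (mul_le_of_le_one_left (abs_nonneg _) (hs k)).trans (abs_windowIntegral_sub_le k hab hθ δ)

/-! ### Correlation of an alternating sequence with a cosine. -/

/-- A quadratic minorant, so that its sum over a half-block is explicit. -/
theorem three_quarters_sub_le_cos_sub_abs_sin (y : ℝ) :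
    3 / 4 - 3 / 2 * y ^ 2 ≤ Real.cos y - |Real.sin y| := by
  have h1 := Real.one_sub_sq_div_two_le_cos (x := y)
  have h2 : |Real.sin y| ≤ |y| := Real.abs_sin_le_abs
  have h3 : |y| ≤ y ^ 2 + 1 / 4 := by
    rw [← sq_abs y]
    nlinarith [sq_nonneg (|y| - 1 / 2)]
  linarith

theorem sum_range_add_sq (n : ℕ) (c : ℝ) :
    ∑ r ∈ Finset.range n, ((r : ℝ) + c) ^ 2 =
      n * (n - 1) * (2 * n - 1) / 6 + c * (n * (n - 1)) + n * c ^ 2 := by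
  induction n with
  | zero => simp
  | succ n ih => rw [Finset.sum_range_succ, ih]; push_cast; ring

theorem sq_pi_div_le {h : ℕ} (hh : 0 < h) :
    (Real.pi / (4 * h)) ^ 2 ≤ 5 / 8 / (h : ℝ) ^ 2 := by
  have hpi : Real.pi ^ 2 ≤ 10 := by
    nlinarith [Real.pi_lt_d2, Real.pi_pos]
  have hh' : (0 : ℝ) < h := by exact_mod_cast hh
  rw [div_pow, div_le_div_iff₀ (by positivity) (by positivity)]
  nlinarith [mul_le_mul_of_nonneg_right hpi (sq_nonneg (h : ℝ))]

/-- Here `cos` is the gain from a prescribed index and `|sin|` the worst loss at the free index `2h`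
places later. The drift `e` of the block against the cosine costs an amount independent of `h`. -/
theorem sum_cos_sub_abs_sin_ge {h : ℕ} (hh : 0 < h) (e : ℝ) (he : 0 ≤ e) :
    (h : ℝ) / 2 - 2 * e ^ 2 ≤ ∑ r ∈ Finset.range (2 * h),
      (Real.cos (Real.pi / (4 * h) * (r + (e - h))) -
        |Real.sin (Real.pi / (4 * h) * (r + (e - h)))|) := by
  have hh' : (1 : ℝ) ≤ h := by exact_mod_cast hh
  refine le_trans ?_ (Finset.sum_le_sum fun r _ => three_quarters_sub_le_cos_sub_abs_sin _)
  simp only [mul_pow]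
  rw [Finset.sum_sub_distrib, Finset.sum_const, Finset.card_range, ← Finset.mul_sum,
    ← Finset.mul_sum, sum_range_add_sq, nsmul_eq_mul]
  push_cast
  set S : ℝ := 2 * h * (2 * h - 1) * (2 * (2 * h) - 1) / 6 + (e - h) * (2 * h * (2 * h - 1)) +
    2 * h * (e - h) ^ 2 with hS
  have hS1 : S = (2 * (h : ℝ) ^ 3 + h) / 3 - 2 * e * h + 2 * h * e ^ 2 := by rw [hS]; ring
  have hS2 : S ≤ (h : ℝ) ^ 2 * (h + 2 * e ^ 2) := by
    have h1 : (h : ℝ) ≤ h ^ 2 := by nlinarith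
    have h2 : (h : ℝ) ^ 2 ≤ h ^ 3 := by nlinarith
    have h3 : (h : ℝ) * e ^ 2 ≤ h ^ 2 * e ^ 2 := mul_le_mul_of_nonneg_right h1 (sq_nonneg e)
    have h4 : 0 ≤ e * h := by positivity
    rw [hS1]; nlinarith
  have hm : (Real.pi / (4 * h)) ^ 2 * S ≤ 5 / 8 * (h + 2 * e ^ 2) := by
    calc (Real.pi / (4 * h)) ^ 2 * S
        ≤ (Real.pi / (4 * h)) ^ 2 * ((h : ℝ) ^ 2 * (h + 2 * e ^ 2)) := by gcongr
      _ ≤ 5 / 8 / (h : ℝ) ^ 2 * ((h : ℝ) ^ 2 * (h + 2 * e ^ 2)) := by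
        gcongr; exact sq_pi_div_le hh
      _ = 5 / 8 * (h + 2 * e ^ 2) := by field_simp
  nlinarith [sq_nonneg e]

/-- A bounded sequence with prescribed sign `(-1)ᵐ` on the first half of the block starting at
`m²`. -/
structure IsAlternatingSign (s : ℕ → ℝ) : Prop where
  abs_le_one : ∀ k, |s k| ≤ 1
  eq_neg_one_pow : ∀ m k : ℕ, m ^ 2 ≤ k → k < m ^ 2 + m → s k = (-1) ^ m

/-- Correlation of one block with a cosine whose half-period is the length of the central block. -/
theorem IsAlternatingSign.block_sum_ge {s : ℕ → ℝ} (hs : IsAlternatingSign s) {h : ℕ} (hh : 0 < h)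
    (i : ℕ) :
    (h : ℝ) / 2 - 2 * i ^ 4 - (2 * i + 1) ≤
      ∑ k ∈ Finset.Ico ((2 * h + i) ^ 2) ((2 * h + (i + 1)) ^ 2),
        s k * Real.cos (Real.pi / (4 * h) * (k - 4 * h ^ 2 - h)) := by
  have hh' : (h : ℝ) ≠ 0 := by positivity
  set θ : ℝ := Real.pi / (4 * h) with hθ
  have hlen : (2 * h + (i + 1)) ^ 2 - (2 * h + i) ^ 2 = 2 * h + (2 * h + (2 * i + 1)) := by
    rw [Nat.sub_eq_iff_eq_add (Nat.pow_le_pow_left (by omega) 2)]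
    ring
  -- Since `(2h+i)² = 4h² + 4hi + i²`, the term `4hi` is `i` half-periods and yields the sign, while
  -- `i²` is the drift.
  have harg : ∀ r : ℕ, Real.cos (θ * (((2 * h + i) ^ 2 + r : ℕ) - 4 * h ^ 2 - h)) =
      (-1) ^ i * Real.cos (θ * (r + ((i : ℝ) ^ 2 - h))) := by
    intro r
    rw [← Real.cos_add_nat_mul_pi]
    congr 1
    rw [hθ]
    push_cast
    field_simp
    ring
  have hsq : ((-1 : ℝ) ^ i) * (-1) ^ i = 1 := by rw [← mul_pow]; simp
  rw [Finset.sum_Ico_eq_sum_range, hlen, Finset.sum_range_add, Finset.sum_range_add]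
  have h1 : ∀ r ∈ Finset.range (2 * h), s ((2 * h + i) ^ 2 + r) *
      Real.cos (θ * (((2 * h + i) ^ 2 + r : ℕ) - 4 * h ^ 2 - h)) =
      Real.cos (θ * (r + ((i : ℝ) ^ 2 - h))) := by
    intro r hr
    rw [harg, hs.eq_neg_one_pow (2 * h + i) _ (by omega)
      (by have := Finset.mem_range.1 hr; omega), pow_add, pow_mul]
    linear_combination Real.cos (θ * (r + ((i : ℝ) ^ 2 - h))) * hsq
  -- A shift by `2h` indices is a quarter period and turns `cos` into `-sin`.
  have h2 : ∀ r ∈ Finset.range (2 * h), -|Real.sin (θ * (r + ((i : ℝ) ^ 2 - h)))| ≤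
      s ((2 * h + i) ^ 2 + (2 * h + r)) *
        Real.cos (θ * (((2 * h + i) ^ 2 + (2 * h + r) : ℕ) - 4 * h ^ 2 - h)) := by
    intro r _
    have e : θ * (((2 * h + r : ℕ) : ℝ) + ((i : ℝ) ^ 2 - h)) =
        θ * (r + ((i : ℝ) ^ 2 - h)) + Real.pi / 2 := by
      rw [hθ]; push_cast; field_simp; ring
    rw [harg, e, Real.cos_add_pi_div_two]
    refine neg_le_of_abs_le ?_
    rw [abs_mul, abs_mul, abs_pow, abs_neg, abs_one, one_pow, one_mul, abs_neg]
    exact mul_le_of_le_one_left (abs_nonneg _) (hs.abs_le_one _)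
  have h3 : ∀ r ∈ Finset.range (2 * i + 1), (-1 : ℝ) ≤
      s ((2 * h + i) ^ 2 + (2 * h + (2 * h + r))) *
        Real.cos (θ * (((2 * h + i) ^ 2 + (2 * h + (2 * h + r)) : ℕ) - 4 * h ^ 2 - h)) := by
    intro r _
    refine neg_le_of_abs_le ?_
    rw [abs_mul]
    exact mul_le_one₀ (hs.abs_le_one _) (abs_nonneg _) (Real.abs_cos_le_one _)
  have h4 := sum_cos_sub_abs_sin_ge hh ((i : ℝ) ^ 2) (by positivity)
  rw [Finset.sum_sub_distrib] at h4
  rw [Finset.sum_congr rfl h1]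
  have h5 := Finset.sum_le_sum h2
  have h6 := Finset.sum_le_sum h3
  rw [Finset.sum_neg_distrib] at h5
  rw [Finset.sum_const, Finset.card_range, nsmul_eq_mul] at h6
  push_cast at h4 h5 h6 ⊢
  linarith

theorem IsAlternatingSign.sum_ge {s : ℕ → ℝ} (hs : IsAlternatingSign s) {h : ℕ} (hh : 0 < h)
    (n : ℕ) :
    (n : ℝ) * (h / 2 - 2 * n ^ 4 - (2 * n + 1)) ≤
      ∑ k ∈ Finset.Ico ((2 * h) ^ 2) ((2 * h + n) ^ 2),
        s k * Real.cos (Real.pi / (4 * h) * (k - 4 * h ^ 2 - h)) := by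
  have key : ∀ j ≤ n, (j : ℝ) * (h / 2 - 2 * n ^ 4 - (2 * n + 1)) ≤
      ∑ k ∈ Finset.Ico ((2 * h) ^ 2) ((2 * h + j) ^ 2),
        s k * Real.cos (Real.pi / (4 * h) * (k - 4 * h ^ 2 - h)) := by
    intro j
    induction j with
    | zero => simp
    | succ j ih =>
      intro hj
      rw [← Finset.sum_Ico_consecutive _ (Nat.pow_le_pow_left (by omega : 2 * h ≤ 2 * h + j) 2)
        (Nat.pow_le_pow_left (by omega : 2 * h + j ≤ 2 * h + (j + 1)) 2)]
      have h1 := ih (by omega)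
      have h2 := hs.block_sum_ge hh j
      have h3 : (j : ℝ) ≤ n := by exact_mod_cast (by omega : j ≤ n)
      have h4 : (j : ℝ) ^ 4 ≤ n ^ 4 := by gcongr
      push_cast
      linarith
  exact key n le_rfl

/-- Bernoulli's inequality bounds the power `h²` below by `11/16`, and `4h² + 1 ≤ 5h²`. -/
theorem cos_pow_ge {h : ℕ} (hh : 0 < h) :
    1 / 7 ≤ Real.cos (Real.pi / (4 * h)) ^ (4 * h ^ 2 + 1) := by
  have hh' : (1 : ℝ) ≤ h := by exact_mod_cast hh
  set c := Real.cos (Real.pi / (4 * h)) with hc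
  have hx : 5 / 8 / (h : ℝ) ^ 2 ≤ 5 / 8 := div_le_self (by norm_num) (by nlinarith)
  have h1 : 1 - 5 / 8 / (h : ℝ) ^ 2 / 2 ≤ c := by
    have := Real.one_sub_sq_div_two_le_cos (x := Real.pi / (4 * h))
    have := sq_pi_div_le hh
    linarith
  have hc0 : 0 ≤ c := by linarith
  have hc1 : c ≤ 1 := Real.cos_le_one _
  have h2 : 11 / 16 ≤ c ^ (h ^ 2) := by
    have h3 := one_add_mul_le_pow (a := c - 1) (by linarith) (h ^ 2)
    have h4 : (h : ℝ) ^ 2 * (5 / 8 / (h : ℝ) ^ 2 / 2) = 5 / 16 := by field_simp; norm_num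
    have h5 : (h : ℝ) ^ 2 * (1 - 5 / 8 / (h : ℝ) ^ 2 / 2) ≤ h ^ 2 * c := by gcongr
    rw [add_sub_cancel] at h3
    push_cast at h3
    nlinarith
  calc (1 : ℝ) / 7 ≤ (11 / 16) ^ 5 := by norm_num
    _ ≤ (c ^ (h ^ 2)) ^ 5 := by gcongr
    _ = c ^ (h ^ 2 * 5) := (pow_mul _ _ _).symm
    _ ≤ c ^ (4 * h ^ 2 + 1) := pow_le_pow_of_le_one hc0 hc1 (by nlinarith)

/-- The damping is nearly constant on the window: replacing it by its initial value `D` costs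
`O(n/h)` for each of at most `5hn` terms, hence the `8n²`. -/
theorem IsAlternatingSign.damped_sum_ge {s : ℕ → ℝ} (hs : IsAlternatingSign s) {h : ℕ}
    (hh : 0 < h) {n : ℕ} (hn : n ≤ h) :
    (n : ℝ) * h / 14 - n * (2 * n ^ 4 + (2 * n + 1)) - 8 * n ^ 2 ≤
      ∑ k ∈ Finset.Ico ((2 * h) ^ 2) ((2 * h + n) ^ 2),
        s k * (Real.cos (Real.pi / (4 * h)) ^ (k + 1) *
          Real.cos (Real.pi / (4 * h) * (k - 4 * h ^ 2 - h))) := by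
  have hh' : (1 : ℝ) ≤ h := by exact_mod_cast hh
  have hn' : (n : ℝ) ≤ h := by exact_mod_cast hn
  have h1 := hs.sum_ge hh n
  have hD := cos_pow_ge hh
  set θ := Real.pi / (4 * h) with hθ
  set c := Real.cos θ with hc
  have hθ2 : θ ^ 2 ≤ 5 / 8 / (h : ℝ) ^ 2 := sq_pi_div_le hh
  have hx : 5 / 8 / (h : ℝ) ^ 2 ≤ 5 / 8 := div_le_self (by norm_num) (by nlinarith)
  have hcge : 1 - θ ^ 2 / 2 ≤ c := Real.one_sub_sq_div_two_le_cos
  have hc0 : 0 ≤ c := by linarith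
  have hc1 : c ≤ 1 := Real.cos_le_one _
  set D := c ^ (4 * h ^ 2 + 1) with hDdef
  have hD1 : D ≤ 1 := pow_le_one₀ hc0 hc1
  set w : ℕ → ℝ := fun k => Real.cos (θ * (k - 4 * h ^ 2 - h)) with hw
  have hterm : ∀ k ∈ Finset.Ico ((2 * h) ^ 2) ((2 * h + n) ^ 2),
      D * (s k * w k) - 5 * n / h * (5 / 16) ≤ s k * (c ^ (k + 1) * w k) := by
    intro k hk
    rw [Finset.mem_Ico] at hk
    obtain ⟨j, rfl⟩ := Nat.exists_eq_add_of_le hk.1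
    have hj : j ≤ 5 * h * n := by nlinarith
    have hj' : (j : ℝ) ≤ 5 * h * n := by exact_mod_cast hj
    have hb := one_add_mul_le_pow (a := c - 1) (by linarith) j
    rw [add_sub_cancel] at hb
    have hb2 : 1 - c ^ j ≤ 5 * n / h * (5 / 16) := by
      calc 1 - c ^ j ≤ j * (1 - c) := by linarith
        _ ≤ (5 * h * n) * (5 / 8 / (h : ℝ) ^ 2 / 2) := by
          gcongr
          linarith
        _ = _ := by field_simp; ring
    have hcj : c ^ j ≤ 1 := pow_le_one₀ hc0 hc1
    have hsw : |s ((2 * h) ^ 2 + j) * w ((2 * h) ^ 2 + j)| ≤ 1 := by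
      rw [abs_mul]
      exact mul_le_one₀ (hs.abs_le_one _) (abs_nonneg _) (Real.abs_cos_le_one _)
    have hpow : c ^ ((2 * h) ^ 2 + j + 1) = D * c ^ j := by
      rw [hDdef, ← pow_add]; congr 1; ring
    rw [hpow]
    set v := s ((2 * h) ^ 2 + j) * w ((2 * h) ^ 2 + j)
    have hv : D * (1 - c ^ j) * v ≤ 1 - c ^ j := by
      have h0 : 0 ≤ D * (1 - c ^ j) := mul_nonneg (by linarith) (by linarith)
      calc D * (1 - c ^ j) * v ≤ D * (1 - c ^ j) * 1 :=
            mul_le_mul_of_nonneg_left (le_of_abs_le hsw) h0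
        _ ≤ 1 * (1 - c ^ j) := by
          rw [mul_one]; exact mul_le_mul_of_nonneg_right hD1 (by linarith)
        _ = _ := one_mul _
    have e : s ((2 * h) ^ 2 + j) * (D * c ^ j * w ((2 * h) ^ 2 + j)) =
        D * v - D * (1 - c ^ j) * v := by ring
    rw [e]
    linarith
  have h2 := Finset.sum_le_sum hterm
  rw [Finset.sum_sub_distrib, ← Finset.mul_sum, Finset.sum_const, Nat.card_Ico, nsmul_eq_mul,
    Nat.cast_sub (Nat.pow_le_pow_left (by omega) 2)] at h2
  refine le_trans ?_ h2
  have h3 : (((2 * h + n) ^ 2 : ℕ) - ((2 * h) ^ 2 : ℕ) : ℝ) * (5 * n / h * (5 / 16)) ≤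
      8 * n ^ 2 := by
    have : (((2 * h + n) ^ 2 : ℕ) - ((2 * h) ^ 2 : ℕ) : ℝ) ≤ 5 * h * n := by
      push_cast; nlinarith
    calc _ ≤ (5 * h * n : ℝ) * (5 * n / h * (5 / 16)) := by gcongr
      _ = 125 / 16 * n ^ 2 := by field_simp; ring
      _ ≤ 8 * n ^ 2 := by gcongr; norm_num
  have h4 : D * ((n : ℝ) * (h / 2 - 2 * n ^ 4 - (2 * n + 1))) ≤
      D * ∑ k ∈ Finset.Ico ((2 * h) ^ 2) ((2 * h + n) ^ 2), s k * w k := by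
    gcongr
  have h5 : 1 / 7 * ((n : ℝ) * h / 2) ≤ D * ((n : ℝ) * h / 2) := by gcongr
  have h6 : D * ((n : ℝ) * (2 * n ^ 4 + (2 * n + 1))) ≤
      1 * ((n : ℝ) * (2 * n ^ 4 + (2 * n + 1))) := by
    gcongr
  have h7 : D * ((n : ℝ) * (h / 2 - 2 * n ^ 4 - (2 * n + 1))) =
    D * ((n : ℝ) * h / 2) - D * ((n : ℝ) * (2 * n ^ 4 + (2 * n + 1))) := by ring
  linarith

/-! ### Upper bound under convergence, and the contradiction. -/

theorem abs_integral_cos_le {β : ℝ} (hβ : 0 < β) (δ x y : ℝ) :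
    |∫ t in x..y, Real.cos (β * t - δ)| ≤ 2 / β := by
  rw [intervalIntegral.integral_comp_mul_sub _ hβ.ne', integral_cos, smul_eq_mul, abs_mul,
    abs_of_pos (inv_pos.2 hβ), div_eq_inv_mul]
  gcongr
  refine (abs_sub _ _).trans ?_
  linarith [Real.abs_sin_le_one (β * y - δ), Real.abs_sin_le_one (β * x - δ)]

theorem abs_integral_mul_cos_le {F : ℝ → ℝ} (hF : Continuous F) {L ε β : ℝ} (hβ : 0 < β) (δ : ℝ)
    {x y : ℝ} (hxy : x ≤ y) (hL : ∀ t, x ≤ t → |F t - L| ≤ ε) :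
    |∫ t in x..y, F t * Real.cos (β * t - δ)| ≤ ε * (y - x) + |L| * (2 / β) := by
  have e : ∫ t in x..y, F t * Real.cos (β * t - δ) =
      (∫ t in x..y, (F t - L) * Real.cos (β * t - δ)) +
        L * ∫ t in x..y, Real.cos (β * t - δ) := by
    rw [← intervalIntegral.integral_const_mul, ← intervalIntegral.integral_add
      (Continuous.intervalIntegrable (by fun_prop) _ _)
      (Continuous.intervalIntegrable (by fun_prop) _ _)]
    congr 1
    funext t
    ring
  rw [e]
  refine (abs_add_le _ _).trans (add_le_add ?_ ?_)
  · have h := intervalIntegral.norm_integral_le_of_norm_le_const (a := x) (b := y) (C := ε)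
      (f := fun t => (F t - L) * Real.cos (β * t - δ)) fun t ht => by
        rw [uIoc_of_le hxy] at ht
        rw [norm_mul, Real.norm_eq_abs, Real.norm_eq_abs]
        exact (mul_le_of_le_one_right (abs_nonneg _) (Real.abs_cos_le_one _)).trans
          (hL t ht.1.le)
    rwa [abs_of_nonneg (sub_nonneg.2 hxy)] at h
  · rw [abs_mul]
    gcongr
    exact abs_integral_cos_le hβ δ x y

/-- The Borel (Poisson) means of an alternating sequence do not converge. -/
theorem IsAlternatingSign.not_tendsto {s : ℕ → ℝ} (hs : IsAlternatingSign s) {F : ℝ → ℝ}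
    (hF : Continuous F) (hFs : ∀ t, F t = ∑' k, s k * poissonWeight k t) (L : ℝ) :
    ¬ Tendsto F atTop (𝓝 L) := by
  intro hlim
  obtain ⟨n, hn⟩ := exists_nat_ge (20 * (3 * |L| + 5))
  obtain ⟨T, hT⟩ := Filter.eventually_atTop.1 (Metric.tendsto_nhds.1 hlim (1 / 200) (by norm_num))
  -- `C` dominates all error terms free of `h`; as `n` and `T` are already fixed, `h` can be taken
  -- larger than it.
  set C : ℝ := n * (2 * n ^ 4 + (2 * n + 1)) + 8 * n ^ 2 + n ^ 2 + n with hC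
  obtain ⟨h, hh⟩ := exists_nat_ge (1 + n + |T| + C)
  have hC0 : 0 ≤ C := by positivity
  have hn0 : (0 : ℝ) ≤ n := n.cast_nonneg
  have hT0 := abs_nonneg T
  have hh1 : (1 : ℝ) ≤ h := by linarith
  have hhn : n ≤ h := by exact_mod_cast (by linarith : (n : ℝ) ≤ h)
  have hpos : 0 < h := by exact_mod_cast (by linarith : (0 : ℝ) < h)
  set θ := Real.pi / (4 * h) with hθ
  have hθ0 : 0 < θ := by positivity
  have hθ1 : θ < Real.pi / 2 := by
    rw [hθ]
    exact div_lt_div_of_pos_left Real.pi_pos (by norm_num) (by linarith)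
  have hcos : 0 < Real.cos θ := Real.cos_pos_of_mem_Ioo ⟨by linarith, hθ1⟩
  have hab : (2 * h) ^ 2 ≤ (2 * h + n) ^ 2 := Nat.pow_le_pow_left (by omega) 2
  -- The phase puts a maximum of the cosine at `k = 4h² + h`, the middle of the prescribed run
  -- starting at `(2h)²`.
  set δ : ℝ := θ * (1 + 4 * h ^ 2 + h) with hδ
  have h1 := abs_integral_tsum_sub_le hs.abs_le_one (a := (2 * h) ^ 2) (by positivity) hab hcos δ
  have h2 := hs.damped_sum_ge hpos hhn
  have hang : ∀ k : ℕ, ((k : ℝ) + 1) * θ - δ = θ * (k - 4 * h ^ 2 - h) := fun k => by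
    rw [hδ]; ring
  simp only [hang, ← hFs] at h1
  have hβ : θ ≤ Real.tan θ := Real.le_tan hθ0.le hθ1
  have h3 := abs_integral_mul_cos_le hF (hθ0.trans_le hβ) δ
    (Nat.cast_le (α := ℝ).2 hab) (L := L) (ε := 1 / 200) fun t ht => by
      have : T ≤ t := by
        push_cast at ht
        have := le_abs_self T
        nlinarith
      have := hT t this
      rw [Real.dist_eq] at this
      exact this.le
  have h4 : 2 / Real.tan θ ≤ 3 * h := by
    calc 2 / Real.tan θ ≤ 2 / θ := by gcongr
      _ = 8 / Real.pi * h := by rw [hθ]; field_simp; norm_num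
      _ ≤ 3 * h := by
        gcongr
        rw [div_le_iff₀ Real.pi_pos]
        linarith [Real.pi_gt_three]
  have h5 : |L| * (2 / Real.tan θ) ≤ |L| * (3 * h) := by gcongr
  have h6 : √(((2 * h) ^ 2 : ℕ) : ℝ) = 2 * h := by
    push_cast; exact Real.sqrt_sq (by positivity)
  have h7 : √(((2 * h + n) ^ 2 : ℕ) : ℝ) = 2 * h + n := by
    push_cast; exact Real.sqrt_sq (by positivity)
  rw [h6, h7] at h1
  have h8 := (abs_le.1 h1).1
  have h9 := (abs_le.1 h3).2
  have h10 : (((2 * h + n) ^ 2 : ℕ) - ((2 * h) ^ 2 : ℕ) : ℝ) = 4 * h * n + n ^ 2 := by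
    push_cast; ring
  rw [h10] at h9
  have h11 : 20 * (3 * |L| + 5) * h ≤ n * h := by gcongr
  -- The coefficient of `n h` is `1/14 - 4/200 ≥ 1/20`, so the choice of `n` leaves `(3|L| + 5) h`
  -- against `(3|L| + 4) h + C`, and `h > C`.
  nlinarith

/-! ### Poisson representation of the pursuit solution. -/

theorem rightShift_pow_apply (k : ℕ) (x : BddSeq) (n : ℤ) : (rightShift ^ k) x n = x (n - k) := by
  induction k generalizing n with
  | zero => simp
  | succ k ih =>
    rw [pow_succ']
    show rightShift ((rightShift ^ k) x) n = _
    rw [rightShift_apply, ih, sub_sub, Nat.cast_succ, add_comm]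

theorem hasSum_exp_smul_sub_one {A : Type*} [NormedRing A] [NormedAlgebra ℝ A] [CompleteSpace A]
    (x : A) (t : ℝ) :
    HasSum (fun k => poissonWeight k t • x ^ k) (NormedSpace.exp (t • (x - 1))) := by
  let _ : NormedAlgebra ℚ A := NormedAlgebra.restrictScalars ℚ ℝ A
  have e : t • (x - 1) = algebraMap ℝ A (-t) + t • x := by
    rw [Algebra.algebraMap_eq_smul_one, smul_sub, neg_smul]
    abel
  have hexp : NormedSpace.exp (t • (x - 1)) = Real.exp (-t) • NormedSpace.exp (t • x) := by
    rw [e, NormedSpace.exp_add_of_commute (Algebra.commutes _ _),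
      ← NormedSpace.algebraMap_exp_comm, congrFun Real.exp_eq_exp_ℝ (-t), ← Algebra.smul_def]
  rw [hexp]
  refine ((NormedSpace.exp_series_hasSum_exp' (𝕂 := ℝ) (t • x)).const_smul
    (Real.exp (-t))).congr_fun fun k => ?_
  rw [smul_pow, smul_smul, smul_smul, poissonWeight]
  congr 1
  ring

theorem hasSum_pursuit (q₀ : BddSeq) (t : ℝ) (n : ℤ) :
    HasSum (fun k : ℕ => q₀ (n - k) * poissonWeight k t) (pursuit q₀ t n) := by
  have h := ((lp.evalCLM ℝ (fun _ : ℤ => ℝ) ∞ n).comp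
    (ContinuousLinearMap.apply ℝ BddSeq q₀)).hasSum (hasSum_exp_smul_sub_one rightShift t)
  refine HasSum.congr_fun h fun k => ?_
  rw [← rightShift_pow_apply, mul_comm]
  rfl

theorem exists_isAlternatingStart : ∃ q₀ : BddSeq, IsAlternatingStart q₀ := by
  have hsqrt : ∀ m k : ℕ, m ^ 2 ≤ k → k < m ^ 2 + m → Nat.sqrt (-(k : ℤ)).natAbs = m := by
    intro m k h1 h2
    rw [Int.natAbs_neg, Int.natAbs_natCast, eq_comm, Nat.eq_sqrt']
    exact ⟨h1, by nlinarith⟩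
  -- `Nat.sqrt k = m` on the whole block `[m², (m+1)²)`, so its parity gives the prescribed values.
  let f : ℤ → ℝ := fun n => if Even (Nat.sqrt n.natAbs) then 1 else 0
  have hf : Memℓp f ∞ := by
    refine memℓp_infty ⟨1, ?_⟩
    rintro _ ⟨n, rfl⟩
    by_cases h : Even (Nat.sqrt n.natAbs) <;> simp [f, h]
  refine ⟨⟨f, hf⟩, fun n => ?_, fun m k hm h1 h2 => ?_, fun m k hm h1 h2 => ?_⟩
  · by_cases h : Even (Nat.sqrt n.natAbs)
    · exact Or.inr (if_pos h)
    · exact Or.inl (if_neg h)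
  · exact if_pos (by rwa [hsqrt m k h1 h2])
  · exact if_neg (by rwa [hsqrt m k h1 h2, Nat.not_even_iff_odd])

theorem IsAlternatingStart.isAlternatingSign {q₀ : BddSeq} (hq : IsAlternatingStart q₀) :
    IsAlternatingSign fun k : ℕ => 2 * q₀ (0 - k) - 1 where
  abs_le_one k := by
    rcases hq.zero_or_one (0 - k) with h | h <;> norm_num [h]
  eq_neg_one_pow m k h1 h2 := by
    rw [zero_sub]
    rcases m.even_or_odd with hm | hm
    · rw [hq.even_block m k hm h1 h2, hm.neg_one_pow]; norm_num
    · rw [hq.odd_block m k hm h1 h2, hm.neg_one_pow]; norm_num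

theorem IsAlternatingStart.not_tendsto {q₀ : BddSeq} (hq : IsAlternatingStart q₀) (L : ℝ) :
    ¬ Tendsto (fun t : ℝ => pursuit q₀ t 0) atTop (𝓝 L) := by
  intro h
  have hc : Continuous fun t : ℝ => pursuit q₀ t 0 :=
    continuous_iff_continuousAt.2 fun t => (hasDerivAt_pursuit_apply q₀ 0 t).continuousAt
  refine hq.isAlternatingSign.not_tendsto (F := fun t => 2 * pursuit q₀ t 0 - 1) (by fun_prop)
    (fun t => ?_) (2 * L - 1) ((h.const_mul 2).sub_const 1)
  refine (HasSum.tsum_eq ?_).symm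
  refine (((hasSum_pursuit q₀ t 0).mul_left 2).sub (hasSum_poissonWeight t)).congr_fun ?_
  intro k
  ring

end CarChain

theorem mainTheorem7 :
    (∃ q₀ : CarChain.BddSeq, CarChain.IsAlternatingStart q₀) ∧
      ∀ q₀ : CarChain.BddSeq, CarChain.IsAlternatingStart q₀ →
        ¬ ∃ L : ℝ, Tendsto (fun t : ℝ => CarChain.pursuit q₀ t 0) atTop (𝓝 L) :=
  ⟨CarChain.exists_isAlternatingStart, fun _ hq ⟨L, hL⟩ => hq.not_tendsto L hL⟩
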